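/- **Lemma (Markov Lemma for Nested Linear Codes).** Let $\mathcal X$ be a finite set, $\mathbb F_q$ a finite field with $q$ elements and $K\ge 0$, and let $(X,U_1,\dots,U_K)\sim p(x)\prod_{k=1}^K p(u_k|x)$ with $X\in\mathcal X$ and $U_k\in\mathbb F_q$. Logarithms are to base $2$. For a random variable $V$ on a finite alphabet let $\mathcal T^{(n)}_\epsilon(V)$ be the set of sequences $v^n$ such that $\big|\tfrac1n|\{i:v_i=v\}|-p_V(v)\big|\le\epsilon\,p_V(v)$ for all letters $v$; for tuples of random variables, sequences of tuples are used. Let $p_q$ be the uniform distribution on $\mathbb F_q$, $D(\cdot\|\cdot)$ relative entropy and $I(\cdot\,;\cdot)$ mutual information. *Code.* For rates $\hat R_1,\dots,\hat R_K$ let $[2^{n\hat R_k}]$ be the set of integers $0\le l<2^{n\hat R_k}$, let $n_k=\lceil n\hat R_k/\log q\rceil$ and $\kappa=\max_k n_k$, and let $\boldsymbol\eta_k(l)\in\mathbb F_q^{\kappa}$ be the $q$-ary expansion of $l$ with $n_k$ digits (the digits $0,\dots,q-1$ being identified with the elements of $\mathbb F_q$ by any fixed bijection), followed by zeros. Let $\mathbf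 G\in\mathbb F_q^{\kappa\times n}$ and $D_1^n,\dots,D_K^n\in\mathbb F_q^n$ have i.i.d. uniform entries, and let $U_k^n(l)=\boldsymbol\eta_k(l)\mathbf G\oplus D_k^n$ for $l\in[2^{n\hat R_k}]$. *Encoding.* Given $x^n$, user $k$ chooses $L_k$ uniformly among the indices $l\in[2^{n\hat R_k}]$ with $(x^n,U_k^n(l))\in\mathcal T^{(n)}_{\epsilon'}(X,U_k)$, and uniformly in $[2^{n\hat R_k}]$ if there is no such index; given $\mathbf G$ and the dithers, the choices of the $K$ users are independent. *Claim.* There is a function $\delta:(0,\infty)\to(0,\infty)$ with $\delta(t)\to0$ as $t\to0$, depending only on the distribution of $(X,U_1,\dots,U_K)$, such that the following holds. For every $\epsilon\in(0,1)$ there is $\epsilon_0\in(0,\epsilon]$ such that for all $0<\epsilon''<\epsilon'<\epsilon_0$ and all rates with $$\hat R_k> I(U_k;X)+D(p_{U_k}\|p_q)+\delta(\epsilon'),\qquad k=1,\dots,K,$$ one has $$\mathbb P\big\{(x^n,U_1^n(L_1),\dots,U_K^n(L_K))\in\mathcal T^{(n)}_\epsilon(X,U_1,\dots,U_K)\big\}\longrightarrow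 1\qquad(n\to\infty)$$ uniformly in $x^n\in\mathcal T^{(n)}_{\epsilon''}(X)$: for every $\eta>0$ and all sufficiently large $n$ this probability is at least $1-\eta$ for every $x^n\in\mathcal T^{(n)}_{\epsilon''}(X)$. No upper bound on the rates $\hat R_k$ is required. -/

import Mathlib

open Filter Topology

noncomputable section

namespace NestedLinear

/-! ### Types, typical sets, information measures (logarithms to base 2) -/

section Info

variable {α β : Type*} [Fintype α] [Fintype β]

open Classical in
/-- The type (empirical mass function) `π(a | xⁿ) = |{i : xᵢ = a}| / n`. -/
def empType {n : ℕ} (xs : Fin n → α) (a : α) : ℝ :=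
  ((Finset.univ.filter fun i => xs i = a).card : ℝ) / n

/-- The robust `ε`-typical set: `|π(a | xⁿ) - p(a)| ≤ ε p(a)` for all letters `a`. -/
def typicalSet (p : PMF α) (ε : ℝ) (n : ℕ) : Set (Fin n → α) :=
  {xs | ∀ a, |empType xs a - (p a).toReal| ≤ ε * (p a).toReal}

/-- Relative entropy `D(p‖q)` in bits, for `q` of full support. -/
def relEntropy (p q : PMF α) : ℝ :=
  ∑ a, (p a).toReal * Real.logb 2 ((p a).toReal / (q a).toReal)

/-- Mutual information, in bits, of a pair with joint law `r`. -/
def mutualInfo (r : PMF (α × β)) : ℝ :=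
  ∑ z : α × β, (r z).toReal *
    Real.logb 2 ((r z).toReal / (((r.map Prod.fst) z.1).toReal * ((r.map Prod.snd) z.2).toReal))

end Info

/-! ### The target law `p(x) ∏ₖ p(uₖ | x)` and its marginals -/

section Law

variable {𝒳 F : Type*} [Fintype 𝒳] [Fintype F] {K : ℕ}

theorem joint_sum (pX : PMF 𝒳) (pU : Fin K → 𝒳 → PMF F) :
    ∑ z : 𝒳 × (Fin K → F), pX z.1 * ∏ k, pU k z.1 (z.2 k) = 1 := by
  classical
  rw [Fintype.sum_prod_type]
  have h : ∀ x : 𝒳, ∑ u : Fin K → F, pX x * ∏ k, pU k x (u k) = pX x := by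
    intro x
    rw [← Finset.mul_sum, ← Fintype.prod_sum]
    have hk : ∀ k, ∑ a, pU k x a = 1 := by
      intro k
      rw [← tsum_fintype (L := .unconditional _)]
      exact (pU k x).tsum_coe
    simp [hk]
  simp only [h]
  rw [← tsum_fintype (L := .unconditional _)]
  exact pX.tsum_coe

/-- The law of `(X, U₁, …, U_K) ∼ p(x) ∏ₖ p(uₖ | x)`. -/
def jointLaw (pX : PMF 𝒳) (pU : Fin K → 𝒳 → PMF F) : PMF (𝒳 × (Fin K → F)) :=
  PMF.ofFintype (fun z => pX z.1 * ∏ k, pU k z.1 (z.2 k)) (joint_sum pX pU)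

/-- The law of `(X, Uₖ)`. -/
def pairLaw (pX : PMF 𝒳) (pU : Fin K → 𝒳 → PMF F) (k : Fin K) : PMF (𝒳 × F) :=
  (jointLaw pX pU).map fun z => (z.1, z.2 k)

/-- The law of `Uₖ`. -/
def userLaw (pX : PMF 𝒳) (pU : Fin K → 𝒳 → PMF F) (k : Fin K) : PMF F :=
  (jointLaw pX pU).map fun z => z.2 k

end Law

/-! ### Dithered linear codes with a common generator matrix -/

/-- The number of indices in `[2^{nR}]`, i.e. of naturals `l < 2^{nR}`. -/
def numIndices (n : ℕ) (R : ℝ) : ℕ := ⌈(2 : ℝ) ^ ((n : ℝ) * R)⌉₊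

theorem numIndices_pos (n : ℕ) (R : ℝ) : 0 < numIndices n R :=
  Nat.ceil_pos.mpr (by positivity)

section Code

variable (F : Type*) [Field F] [Fintype F]

/-- The length `⌈nR / log₂ q⌉` of the `q`-ary expansion of an index in `[2^{nR}]`. -/
def numDigits (n : ℕ) (R : ℝ) : ℕ := ⌈(n : ℝ) * R / Real.logb 2 (Fintype.card F)⌉₊

/-- The common number `κ` of rows of the generator matrix. -/
def maxDigits {K : ℕ} (n : ℕ) (R : Fin K → ℝ) : ℕ :=
  Finset.univ.sup fun k => numDigits F n (R k)

/-- A realization of the generator matrix and of the `K` dithers. -/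
abbrev Codebook {K : ℕ} (n : ℕ) (R : Fin K → ℝ) : Type _ :=
  Matrix (Fin (maxDigits F n R)) (Fin n) F × (Fin K → Fin n → F)

variable {F}

/-- The `q`-ary expansion of `l` with `m` digits (least significant first), followed by zeros to
length `κ`; `e` labels the field elements by the digits `0, …, q - 1`. -/
def expand (e : Fin (Fintype.card F) ≃ F) (m κ l : ℕ) : Fin κ → F := fun i =>
  if (i : ℕ) < m then
    e ⟨l / Fintype.card F ^ (i : ℕ) % Fintype.card F, Nat.mod_lt _ Fintype.card_pos⟩
  else 0

variable {K n : ℕ} {R : Fin K → ℝ}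

/-- The codeword `uₖⁿ(l) = η(l) G ⊕ dₖⁿ` of user `k`. -/
def codeword (e : Fin (Fintype.card F) ≃ F) (c : Codebook F n R) (k : Fin K)
    (l : Fin (numIndices n (R k))) : Fin n → F :=
  Matrix.vecMul (expand e (numDigits F n (R k)) (maxDigits F n R) l) c.1 + c.2 k

variable {𝒳 : Type*} [Fintype 𝒳]

open Classical in
/-- The indices whose codeword is jointly `ε'`-typical with `xⁿ`. -/
def typicalIndices (pX : PMF 𝒳) (pU : Fin K → 𝒳 → PMF F) (e : Fin (Fintype.card F) ≃ F)
    (ε' : ℝ) (x : Fin n → 𝒳) (c : Codebook F n R) (k : Fin K) :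
    Finset (Fin (numIndices n (R k))) :=
  Finset.univ.filter fun l =>
    (fun i => (x i, codeword e c k l i)) ∈ typicalSet (pairLaw pX pU k) ε' n

open Classical in
/-- The indices among which user `k` chooses: the typical ones if there are any, else all. -/
def candidates (pX : PMF 𝒳) (pU : Fin K → 𝒳 → PMF F) (e : Fin (Fintype.card F) ≃ F)
    (ε' : ℝ) (x : Fin n → 𝒳) (c : Codebook F n R) (k : Fin K) :
    Finset (Fin (numIndices n (R k))) :=
  if (typicalIndices pX pU e ε' x c k).Nonempty then typicalIndices pX pU e ε' x c k
  else Finset.univ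

theorem candidates_nonempty (pX : PMF 𝒳) (pU : Fin K → 𝒳 → PMF F)
    (e : Fin (Fintype.card F) ≃ F) (ε' : ℝ) (x : Fin n → 𝒳) (c : Codebook F n R) (k : Fin K) :
    (candidates pX pU e ε' x c k).Nonempty := by
  unfold candidates
  split_ifs with h
  · exact h
  · exact ⟨⟨0, numIndices_pos n (R k)⟩, Finset.mem_univ _⟩

open Classical in
/-- The law of the codebook and of the chosen indices `(L₁, …, L_K)`: all entries of `G` and of
the dithers are i.i.d. uniform on `F`, and, given the codebook, the `Lₖ` are independent, each
uniform on the candidates of its user (so the tuple is uniform on their product). -/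
def encodingLaw (pX : PMF 𝒳) (pU : Fin K → 𝒳 → PMF F) (e : Fin (Fintype.card F) ≃ F)
    (ε' : ℝ) (R : Fin K → ℝ) (x : Fin n → 𝒳) :
    PMF (Codebook F n R × ((k : Fin K) → Fin (numIndices n (R k)))) :=
  (PMF.uniformOfFintype (Codebook F n R)).bind fun c =>
    (PMF.uniformOfFinset (Fintype.piFinset (candidates pX pU e ε' x c))
      (Fintype.piFinset_nonempty.mpr (candidates_nonempty pX pU e ε' x c))).map fun l => (c, l)

/-- The probability that `(xⁿ, U₁ⁿ(L₁), …, U_Kⁿ(L_K))` is jointly `ε`-typical, when the indices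
are chosen with tolerance `ε'`. -/
def probJointlyTypical (pX : PMF 𝒳) (pU : Fin K → 𝒳 → PMF F) (e : Fin (Fintype.card F) ≃ F)
    (ε ε' : ℝ) (R : Fin K → ℝ) (x : Fin n → 𝒳) : ℝ :=
  ((encodingLaw pX pU e ε' R x).toOuterMeasure
    {ω | (fun i => (x i, fun k => codeword e ω.1 k (ω.2 k) i)) ∈
      typicalSet (jointLaw pX pU) ε n}).toReal

end Code

end NestedLinear

end

/-! For fixed `x`, let T_k be the set of sequences u with (x, u) ε'-typical, M_k the number of
indices of user k, H_k = H(U_k|X) and S = ∑ H_k. Randomness of the code enters only through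
surjectivity of additive maps on codebooks, whose fibres have equal size (`card_preimage_mul_card`).
The dithers alone make one codeword from each user jointly uniform, although `G` is shared; dither
and `G` together make two distinct codewords of one user independent.

Pairwise independence and Chebyshev (`card_few_codewords_le`) give each user at least E_k/2 typical
codewords, where E_k = M_k |T_k| / q^n, outside probability 4/E_k. Since I + D = log q - H_k, the
rate condition makes E_k grow exponentially. When every user has that many, the conditional error
probability is at most the number of index tuples with bad codeword tuples times ∏ 2/E_k. Its mean
is |B| ∏ 2/|T_k|, with B the individually but not jointly typical tuples: the M_k cancel, so no
upper bound on the rates is needed (`one_sub_probJointlyTypical_le`).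

Finally |T_k| is at least about exp(n(1-ε')H_k), while |B| is at most exp(n(1+ε')S) times the
conditional probability of joint atypicality, which is at most a constant times exp(-n c) with c
depending on ε but not on ε' (`exists_atypical_weight_le`). Taking ε' small against c/S finishes the
proof. -/

namespace NestedLinear

/-! ### Chernoff concentration and conditional typicality -/

section Concentration

variable {𝒳 V : Type*} [Fintype 𝒳] [Fintype V] {n : ℕ}

open Classical in
/-- A Chernoff bound for sums of independent centred variables with values in `[-1, 1]`. -/
theorem chernoff_bound (w g : Fin n → V → ℝ) (hw0 : ∀ i v, 0 ≤ w i v) (hw1 : ∀ i, ∑ v, w i v = 1)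
    (hg : ∀ i v, |g i v| ≤ 1) (hm : ∀ i, ∑ v, w i v * g i v = 0) {t : ℝ} (ht0 : 0 ≤ t)
    (ht2 : t ≤ 2) :
    ∑ u : Fin n → V with n * t ≤ ∑ i, g i (u i), ∏ i, w i (u i) ≤ Real.exp (-(n * (t ^ 2 / 4))) := by
  -- Exponential tilting with parameter t/2. The hypothesis `t ≤ 2` keeps the tilted exponent in
  -- [-1, 1], where exp s ≤ 1 + s + s².
  have hpt : ∀ u : Fin n → V, n * t ≤ ∑ i, g i (u i) →
      ∏ i, w i (u i) ≤ Real.exp (-(n * (t ^ 2 / 2))) *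
        ∏ i, (w i (u i) * Real.exp (t / 2 * g i (u i))) := by
    intro u hu
    rw [Finset.prod_mul_distrib, ← Real.exp_sum, mul_left_comm, ← Real.exp_add]
    refine le_mul_of_one_le_right (Finset.prod_nonneg fun i _ => hw0 i _) ?_
    rw [← Finset.mul_sum]
    apply Real.one_le_exp
    nlinarith
  have hstep : ∀ i, ∑ v, w i v * Real.exp (t / 2 * g i v) ≤ Real.exp (t ^ 2 / 4) := by
    intro i
    have h1 : ∀ v, w i v * Real.exp (t / 2 * g i v) ≤
        w i v + t / 2 * (w i v * g i v) + w i v * (t ^ 2 / 4) := by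
      intro v
      have ha : |t / 2 * g i v| ≤ 1 := by
        rw [abs_mul, abs_of_nonneg (by linarith : 0 ≤ t / 2)]
        exact mul_le_one₀ (by linarith) (abs_nonneg _) (hg i v)
      have hb := (abs_le.mp (Real.abs_exp_sub_one_sub_id_le ha)).2
      have hc : (t / 2 * g i v) ^ 2 ≤ t ^ 2 / 4 := by
        have : (g i v) ^ 2 ≤ 1 := (sq_le_one_iff_abs_le_one _).mpr (hg i v)
        nlinarith [sq_nonneg t]
      have := mul_le_mul_of_nonneg_left
        (by linarith : Real.exp (t / 2 * g i v) ≤ 1 + t / 2 * g i v + t ^ 2 / 4) (hw0 i v)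
      linarith
    calc _ ≤ ∑ v, (w i v + t / 2 * (w i v * g i v) + w i v * (t ^ 2 / 4)) :=
          Finset.sum_le_sum fun v _ => h1 v
      _ = t ^ 2 / 4 + 1 := by
          rw [Finset.sum_add_distrib, Finset.sum_add_distrib, ← Finset.mul_sum, ← Finset.sum_mul,
            hm, hw1]
          ring
      _ ≤ _ := Real.add_one_le_exp _
  calc _ ≤ ∑ u : Fin n → V with n * t ≤ ∑ i, g i (u i), Real.exp (-(n * (t ^ 2 / 2))) *
        ∏ i, (w i (u i) * Real.exp (t / 2 * g i (u i))) :=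
        Finset.sum_le_sum fun u hu => hpt u (Finset.mem_filter.mp hu).2
    _ ≤ ∑ u : Fin n → V, Real.exp (-(n * (t ^ 2 / 2))) *
        ∏ i, (w i (u i) * Real.exp (t / 2 * g i (u i))) :=
        Finset.sum_le_sum_of_subset_of_nonneg (Finset.filter_subset _ _) fun u _ _ =>
          mul_nonneg (Real.exp_nonneg _)
            (Finset.prod_nonneg fun i _ => mul_nonneg (hw0 i _) (Real.exp_nonneg _))
    _ = Real.exp (-(n * (t ^ 2 / 2))) * ∏ i, ∑ v, w i v * Real.exp (t / 2 * g i v) := by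
        rw [← Finset.mul_sum, Fintype.prod_sum]
    _ ≤ Real.exp (-(n * (t ^ 2 / 2))) * ∏ _i : Fin n, Real.exp (t ^ 2 / 4) := by
        gcongr with i
        · exact fun i _ => Finset.sum_nonneg fun v _ => mul_nonneg (hw0 i v) (Real.exp_nonneg _)
        · exact hstep i
    _ = _ := by
        rw [Finset.prod_const, Finset.card_univ, Fintype.card_fin, ← Real.exp_nat_mul,
          ← Real.exp_add]
        ring_nf

open Classical in
theorem natCast_mul_empType (hn : 0 < n) {α : Type*} (xs : Fin n → α) (a : α) :
    n * empType xs a = ∑ i, if xs i = a then (1 : ℝ) else 0 := by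
  have : (n : ℝ) ≠ 0 := by positivity
  rw [empType, mul_div_cancel₀ _ this]
  simp

theorem sum_comp_eq_sum_empType (hn : 0 < n) {α : Type*} [Fintype α] (xs : Fin n → α)
    (f : α → ℝ) : ∑ i, f (xs i) = n * ∑ a, empType xs a * f a := by
  classical
  rw [Finset.mul_sum]
  simp_rw [← mul_assoc, natCast_mul_empType hn, Finset.sum_mul]
  rw [Finset.sum_comm]
  simp

theorem empType_pos {α : Type*} (xs : Fin n → α) (i : Fin n) : 0 < empType xs (xs i) := by
  classical
  unfold empType
  have hn : (0 : ℝ) < n := by exact_mod_cast i.pos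
  refine div_pos ?_ hn
  exact_mod_cast Finset.card_pos.mpr ⟨i, by simp⟩

theorem pmf_pos_of_mem_typicalSet {α : Type*} [Fintype α] {p : PMF α} {ε : ℝ} {xs : Fin n → α}
    (h : xs ∈ typicalSet p ε n) (i : Fin n) : 0 < (p (xs i)).toReal := by
  refine lt_of_le_of_ne ENNReal.toReal_nonneg fun h0 => ?_
  have h1 := h (xs i)
  rw [← h0, mul_zero, sub_zero] at h1
  exact (abs_pos.mpr (empType_pos xs i).ne').not_ge h1

-- For typical `x`, the frequency of (a, v) in (x, u) differs from π(a) w(v|a) by a centred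
-- independent sum, and π(a) w(v|a) is within ε'' r(a, v) of r(a, v). Atypicality thus forces one of
-- these sums to deviate by the gap γ times a positive mass; a union bound over letters and signs
-- follows. That `c` depends only on the gap, not on the tolerances, is what later allows ε' to be
-- chosen after it.
open Classical in
theorem exists_atypical_weight_le (p : PMF 𝒳) (w : 𝒳 → V → ℝ) (r : PMF (𝒳 × V))
    (hw0 : ∀ a v, 0 ≤ w a v) (hw1 : ∀ a, ∑ v, w a v = 1)
    (hr : ∀ a v, (r (a, v)).toReal = (p a).toReal * w a v) {γ : ℝ} (hγ : 0 < γ) :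
    ∃ c : ℝ, 0 < c ∧ ∀ ε ε'' : ℝ, ε'' + γ ≤ ε → ∀ n : ℕ, 0 < n → ∀ x ∈ typicalSet p ε'' n,
      ∑ u : Fin n → V with (fun i => (x i, u i)) ∉ typicalSet r ε n, ∏ i, w (x i) (u i)
        ≤ 2 * Fintype.card (𝒳 × V) * Real.exp (-(n * c)) := by
  obtain ⟨m, hm0, hm⟩ : ∃ m : ℝ, 0 < m ∧ ∀ z, r z ≠ 0 → m ≤ (r z).toReal := by
    obtain ⟨z₀, hz₀, hmin⟩ := Finset.exists_min_image r.support.toFinset (fun z => (r z).toReal)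
      (by simp)
    exact ⟨_, ENNReal.toReal_pos (by simpa using hz₀) (r.apply_ne_top z₀),
      fun z hz => hmin z (by simpa using hz)⟩
  set t := min 1 (γ * m) with ht
  have ht0 : 0 < t := by positivity
  have ht1 : t ≤ 1 := min_le_left _ _
  refine ⟨t ^ 2 / 4, by positivity, ?_⟩
  intro ε ε'' hε n hn x hx
  have hn' : (0 : ℝ) < n := by exact_mod_cast hn
  let g : 𝒳 × V → Fin n → V → ℝ := fun z i v =>
    if x i = z.1 then (if v = z.2 then 1 else 0) - w z.1 z.2 else 0
  have hwle : ∀ a v, w a v ≤ 1 := fun a v => by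
    rw [← hw1 a]; exact Finset.single_le_sum (fun v _ => hw0 a v) (Finset.mem_univ v)
  have hg : ∀ z i v, |g z i v| ≤ 1 := by
    intro z i v
    have := hw0 z.1 z.2
    have := hwle z.1 z.2
    simp only [g]
    split_ifs <;> rw [abs_le] <;> constructor <;> linarith
  have hgm : ∀ z i, ∑ v, w (x i) v * g z i v = 0 := by
    intro z i
    by_cases h : x i = z.1
    · simp only [g, h, if_true, mul_sub, Finset.sum_sub_distrib, ← Finset.sum_mul, hw1]
      simp
    · simp [g, h]
  have hgs : ∀ z (u : Fin n → V), ∑ i, g z i (u i) =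
      n * (empType (fun i => (x i, u i)) z - empType x z.1 * w z.1 z.2) := by
    intro z u
    rw [mul_sub, ← mul_assoc, natCast_mul_empType hn, natCast_mul_empType hn, Finset.sum_mul,
      ← Finset.sum_sub_distrib]
    refine Finset.sum_congr rfl fun i _ => ?_
    by_cases h1 : x i = z.1 <;> by_cases h2 : u i = z.2 <;> simp [g, Prod.ext_iff, h1, h2]
  have hsub : ∀ u : Fin n → V, (fun i => (x i, u i)) ∉ typicalSet r ε n →
      ∏ i, w (x i) (u i) ≠ 0 →
      ∃ z, n * t ≤ ∑ i, g z i (u i) ∨ n * t ≤ ∑ i, -g z i (u i) := by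
    intro u hu hne
    simp only [typicalSet, Set.mem_ofPred_eq, not_forall, not_le] at hu
    obtain ⟨z, hz⟩ := hu
    refine ⟨z, ?_⟩
    -- A letter of mass zero can occur only where the channel weight vanishes, since typical `x`
    -- uses letters of positive mass; such `u` have product weight zero.
    have hz0 : r z ≠ 0 := by
      intro h0
      rw [h0] at hz
      simp only [ENNReal.toReal_zero, mul_zero, sub_zero, abs_pos] at hz
      have : ∃ i, (x i, u i) = z := by
        by_contra! hc
        apply hz
        simp [empType, hc]
      obtain ⟨i, rfl⟩ := this
      have h1 := hr (x i) (u i)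
      rw [h0, ENNReal.toReal_zero] at h1
      have h2 := (pmf_pos_of_mem_typicalSet hx i).ne'
      have h3 := Finset.prod_ne_zero_iff.mp hne i (Finset.mem_univ i)
      exact mul_ne_zero h2 h3 h1.symm
    have hrz := hm z hz0
    have hrz' := hr z.1 z.2
    rw [Prod.mk.eta] at hrz'
    have h1 : |empType x z.1 * w z.1 z.2 - (r z).toReal| ≤ ε'' * (r z).toReal := by
      rw [hrz', ← sub_mul, abs_mul, abs_of_nonneg (hw0 _ _), ← mul_assoc]
      exact mul_le_mul_of_nonneg_right (hx z.1) (hw0 _ _)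
    have h2 : t ≤ |empType (fun i => (x i, u i)) z - empType x z.1 * w z.1 z.2| := by
      have h3 := abs_sub_le (empType (fun i => (x i, u i)) z) (empType x z.1 * w z.1 z.2)
        (r z).toReal
      have h4 : t ≤ γ * (r z).toReal :=
        (min_le_right _ _).trans (mul_le_mul_of_nonneg_left hrz hγ.le)
      nlinarith [mul_le_mul_of_nonneg_right hε (hm0.le.trans hrz)]
    rw [Finset.sum_neg_distrib, hgs]
    rcases le_abs.mp h2 with h | h
    · exact Or.inl (mul_le_mul_of_nonneg_left h hn'.le)
    · right
      rw [← mul_neg]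
      exact mul_le_mul_of_nonneg_left h hn'.le
  have hP0 : ∀ u : Fin n → V, 0 ≤ ∏ i, w (x i) (u i) := fun u =>
    Finset.prod_nonneg fun i _ => hw0 _ _
  have hch1 := fun z => chernoff_bound (fun i => w (x i)) (g z) (fun i => hw0 _) (fun i => hw1 _)
    (hg z) (hgm z) ht0.le (by linarith)
  have hch2 := fun z => chernoff_bound (fun i => w (x i)) (fun i v => -g z i v) (fun i => hw0 _)
    (fun i => hw1 _) (fun i v => by rw [abs_neg]; exact hg z i v)
    (fun i => by simp only [mul_neg, Finset.sum_neg_distrib, hgm, neg_zero]) ht0.le (by linarith)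
  calc _ ≤ ∑ u : Fin n → V, ∑ z, ((if n * t ≤ ∑ i, g z i (u i) then ∏ i, w (x i) (u i) else 0) +
        (if n * t ≤ ∑ i, -g z i (u i) then ∏ i, w (x i) (u i) else 0)) := by
        rw [Finset.sum_filter]
        refine Finset.sum_le_sum fun u _ => ?_
        have hnn : ∀ z, 0 ≤ ((if n * t ≤ ∑ i, g z i (u i) then ∏ i, w (x i) (u i) else 0) +
            (if n * t ≤ ∑ i, -g z i (u i) then ∏ i, w (x i) (u i) else 0)) := by
          intro z
          have := hP0 u
          split_ifs <;> linarith
        split_ifs with hu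
        · exact Finset.sum_nonneg fun z _ => hnn z
        · by_cases h0 : ∏ i, w (x i) (u i) = 0
          · rw [h0]
            simp
          · obtain ⟨z, hz⟩ := hsub u hu h0
            refine le_trans ?_ (Finset.single_le_sum (fun z _ => hnn z) (Finset.mem_univ z))
            have := hP0 u
            rcases hz with hz | hz
            · rw [if_pos hz]; split_ifs <;> linarith
            · rw [if_pos hz]; split_ifs <;> linarith
    _ = ∑ z, (∑ u : Fin n → V with n * t ≤ ∑ i, g z i (u i), ∏ i, w (x i) (u i) +
        ∑ u : Fin n → V with n * t ≤ ∑ i, -g z i (u i), ∏ i, w (x i) (u i)) := by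
        rw [Finset.sum_comm]
        simp only [Finset.sum_add_distrib, Finset.sum_filter]
    _ ≤ ∑ _z : 𝒳 × V, (Real.exp (-(n * (t ^ 2 / 4))) + Real.exp (-(n * (t ^ 2 / 4)))) :=
        Finset.sum_le_sum fun z _ => add_le_add (hch1 z) (hch2 z)
    _ = _ := by
        rw [Finset.sum_const, Finset.card_univ, nsmul_eq_mul]
        ring

/-- The conditional entropy, in nats, of a channel `w` with input law `p`. -/
noncomputable def condEntropy (p : PMF 𝒳) (w : 𝒳 → V → ℝ) : ℝ :=
  ∑ z : 𝒳 × V, (p z.1).toReal * w z.1 z.2 * -Real.log (w z.1 z.2)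

/-- Minus the log of the product is n times the empirical mean of -log w. Since -log w ≥ 0,
frequencies within factors 1 ± ε of the true masses give the same factors on the entropy. Letters
that occur have positive weight, so the logarithms are genuine. -/
theorem weight_bounds_of_mem_typicalSet (p : PMF 𝒳) (w : 𝒳 → V → ℝ) (r : PMF (𝒳 × V))
    (hw0 : ∀ a v, 0 ≤ w a v) (hw1 : ∀ a, ∑ v, w a v = 1)
    (hr : ∀ a v, (r (a, v)).toReal = (p a).toReal * w a v) {ε : ℝ} (hn : 0 < n)
    {x : Fin n → 𝒳} {u : Fin n → V} (hu : (fun i => (x i, u i)) ∈ typicalSet r ε n) :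
    Real.exp (-(n * ((1 + ε) * condEntropy p w))) ≤ ∏ i, w (x i) (u i) ∧
      ∏ i, w (x i) (u i) ≤ Real.exp (-(n * ((1 - ε) * condEntropy p w))) := by
  have hwle : ∀ a v, w a v ≤ 1 := fun a v => by
    rw [← hw1 a]; exact Finset.single_le_sum (fun v _ => hw0 a v) (Finset.mem_univ v)
  have hpos : ∀ i, 0 < w (x i) (u i) := by
    intro i
    have h := pmf_pos_of_mem_typicalSet hu i
    rw [hr] at h
    exact pos_of_mul_pos_right h ENNReal.toReal_nonneg
  have hlog : ∀ z : 𝒳 × V, 0 ≤ -Real.log (w z.1 z.2) := fun z =>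
    neg_nonneg.mpr (Real.log_nonpos (hw0 _ _) (hwle _ _))
  have hsum : ∏ i, w (x i) (u i) =
      Real.exp (-(n * ∑ z, empType (fun i => (x i, u i)) z * -Real.log (w z.1 z.2))) := by
    rw [← sum_comp_eq_sum_empType hn (fun i => (x i, u i)) (fun z => -Real.log (w z.1 z.2)),
      Finset.sum_neg_distrib, neg_neg, Real.exp_sum]
    exact Finset.prod_congr rfl fun i _ => (Real.exp_log (hpos i)).symm
  have hz : ∀ z, (1 - ε) * ((p z.1).toReal * w z.1 z.2) ≤ empType (fun i => (x i, u i)) z ∧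
      empType (fun i => (x i, u i)) z ≤ (1 + ε) * ((p z.1).toReal * w z.1 z.2) := by
    intro z
    have h := abs_le.mp (hu z)
    have h2 := hr z.1 z.2
    rw [Prod.mk.eta] at h2
    rw [← h2]
    constructor <;> linarith [h.1, h.2]
  rw [hsum]
  constructor
  · gcongr
    rw [condEntropy, Finset.mul_sum]
    refine Finset.sum_le_sum fun z _ => ?_
    rw [← mul_assoc]
    exact mul_le_mul_of_nonneg_right (hz z).2 (hlog z)
  · gcongr
    rw [condEntropy, Finset.mul_sum]
    refine Finset.sum_le_sum fun z _ => ?_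
    rw [← mul_assoc]
    exact mul_le_mul_of_nonneg_right (hz z).1 (hlog z)

theorem condEntropy_nonneg (p : PMF 𝒳) (w : 𝒳 → V → ℝ)
    (hw0 : ∀ a v, 0 ≤ w a v) (hw1 : ∀ a, ∑ v, w a v = 1) : 0 ≤ condEntropy p w := by
  have hwle : ∀ a v, w a v ≤ 1 := fun a v => by
    rw [← hw1 a]; exact Finset.single_le_sum (fun v _ => hw0 a v) (Finset.mem_univ v)
  exact Finset.sum_nonneg fun z _ => mul_nonneg (mul_nonneg ENNReal.toReal_nonneg (hw0 _ _))
    (neg_nonneg.mpr (Real.log_nonpos (hw0 _ _) (hwle _ _)))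

end Concentration

/-! ### Marginals of the target law and the rate threshold -/

section Marginals

variable {𝒳 F : Type*} [Fintype 𝒳] [Fintype F] {K : ℕ}

theorem pmf_sum_eq_one {α : Type*} [Fintype α] (p : PMF α) : ∑ a, p a = 1 := by
  rw [← tsum_fintype (L := .unconditional _)]
  exact p.tsum_coe

theorem pmf_sum_toReal {α : Type*} [Fintype α] (p : PMF α) : ∑ a, (p a).toReal = 1 := by
  rw [← ENNReal.toReal_sum fun a _ => p.apply_ne_top a, pmf_sum_eq_one, ENNReal.toReal_one]

theorem jointLaw_toReal (pX : PMF 𝒳) (pU : Fin K → 𝒳 → PMF F) (a : 𝒳) (v : Fin K → F) :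
    (jointLaw pX pU (a, v)).toReal = (pX a).toReal * ∏ k, (pU k a (v k)).toReal := by
  simp [jointLaw, ENNReal.toReal_mul, ENNReal.toReal_prod]

/-- Moving the indicator into the factor of user `k` makes the sum factorize; every other factor
sums to 1. -/
theorem sum_prod_eq_single (f : Fin K → F → ENNReal) (hf : ∀ k, ∑ b, f k b = 1) (k : Fin K)
    (v : F) : (∑ u : Fin K → F, open Classical in if v = u k then ∏ j, f j (u j) else 0) = f k v := by
  classical
  have h : ∀ u : Fin K → F, (if v = u k then ∏ j, f j (u j) else 0) =
      ∏ j, (if j = k then (if v = u j then f j (u j) else 0) else f j (u j)) := by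
    intro u
    split_ifs with h
    · refine Finset.prod_congr rfl fun j _ => ?_
      by_cases hj : j = k
      · subst hj; simp [h]
      · simp [hj]
    · exact (Finset.prod_eq_zero (Finset.mem_univ k) (by simp [h])).symm
  rw [Finset.sum_congr rfl fun u _ => h u,
    ← Fintype.prod_sum fun j b => if j = k then (if v = b then f j b else 0) else f j b]
  rw [Finset.prod_eq_single k]
  · simp
  · intro j _ hj
    simp [hj, hf]
  · simp

theorem pairLaw_apply (pX : PMF 𝒳) (pU : Fin K → 𝒳 → PMF F) (k : Fin K) (a : 𝒳) (v : F) :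
    pairLaw pX pU k (a, v) = pX a * pU k a v := by
  classical
  rw [pairLaw, PMF.map_apply, tsum_fintype, Fintype.sum_prod_type, Finset.sum_eq_single a]
  · rw [← sum_prod_eq_single (fun j => pU j a) (fun j => pmf_sum_eq_one _) k v, Finset.mul_sum]
    refine Finset.sum_congr rfl fun u _ => ?_
    by_cases h : v = u k <;> simp [h, jointLaw]
  · intro b _ hb
    simp [hb.symm]
  · simp

theorem pairLaw_map_fst (pX : PMF 𝒳) (pU : Fin K → 𝒳 → PMF F) (k : Fin K) :
    (pairLaw pX pU k).map Prod.fst = pX := by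
  classical
  ext a
  rw [PMF.map_apply, tsum_fintype, Fintype.sum_prod_type, Finset.sum_eq_single a]
  · simp [pairLaw_apply, ← Finset.mul_sum, pmf_sum_eq_one]
  · intro b _ hb
    simp [hb.symm]
  · simp

theorem pairLaw_map_snd (pX : PMF 𝒳) (pU : Fin K → 𝒳 → PMF F) (k : Fin K) :
    (pairLaw pX pU k).map Prod.snd = userLaw pX pU k := by
  rw [pairLaw, PMF.map_comp]
  rfl

theorem userLaw_toReal (pX : PMF 𝒳) (pU : Fin K → 𝒳 → PMF F) (k : Fin K) (v : F) :
    (userLaw pX pU k v).toReal = ∑ a, (pairLaw pX pU k (a, v)).toReal := by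
  classical
  rw [← ENNReal.toReal_sum fun a _ => PMF.apply_ne_top _ _, ← pairLaw_map_snd, PMF.map_apply,
    tsum_fintype, Fintype.sum_prod_type]
  simp

/-- `I(Uₖ; X) + D(Uₖ ‖ uniform) = log q - H(Uₖ | X)`. -/
theorem mutualInfo_add_relEntropy [Nonempty F] (pX : PMF 𝒳) (pU : Fin K → 𝒳 → PMF F)
    (k : Fin K) :
    mutualInfo (pairLaw pX pU k) + relEntropy (userLaw pX pU k) (PMF.uniformOfFintype F) =
      (Real.log (Fintype.card F) - condEntropy pX fun a v => (pU k a v).toReal) / Real.log 2 := by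
  have hq : (0 : ℝ) < Fintype.card F := by exact_mod_cast Fintype.card_pos
  have h1 : relEntropy (userLaw pX pU k) (PMF.uniformOfFintype F) =
      ∑ z : 𝒳 × F, (pairLaw pX pU k z).toReal *
        Real.logb 2 ((userLaw pX pU k z.2).toReal / (Fintype.card F : ℝ)⁻¹) := by
    rw [relEntropy, Fintype.sum_prod_type_right]
    refine Finset.sum_congr rfl fun v _ => ?_
    dsimp only
    rw [← Finset.sum_mul, ← userLaw_toReal]
    simp
  have h2 : Real.log (Fintype.card F) =
      ∑ z : 𝒳 × F, (pairLaw pX pU k z).toReal * Real.log (Fintype.card F) := by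
    rw [← Finset.sum_mul, pmf_sum_toReal, one_mul]
  rw [h1, h2, mutualInfo, condEntropy, ← Finset.sum_add_distrib, ← Finset.sum_sub_distrib,
    Finset.sum_div, pairLaw_map_fst, pairLaw_map_snd]
  refine Finset.sum_congr rfl fun z _ => ?_
  have hz : (pairLaw pX pU k z).toReal = (pX z.1).toReal * (pU k z.1 z.2).toReal := by
    rw [← ENNReal.toReal_mul, ← pairLaw_apply]
  -- Zero-mass terms vanish on both sides; elsewhere all masses are positive, so the logarithms
  -- split and the marginal of U_k cancels.
  by_cases h0 : (pairLaw pX pU k z).toReal = 0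
  · simp [h0, ← hz]
  have hx : (pX z.1).toReal ≠ 0 := fun h => h0 (by rw [hz, h, zero_mul])
  have hu : (pU k z.1 z.2).toReal ≠ 0 := fun h => h0 (by rw [hz, h, mul_zero])
  have hv : (userLaw pX pU k z.2).toReal ≠ 0 := by
    rw [userLaw_toReal]
    refine ne_of_gt (lt_of_lt_of_le (lt_of_le_of_ne ENNReal.toReal_nonneg (Ne.symm h0)) ?_)
    exact Finset.single_le_sum (f := fun a => (pairLaw pX pU k (a, z.2)).toReal)
      (fun a _ => ENNReal.toReal_nonneg) (Finset.mem_univ z.1)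
  rw [← hz]
  rw [show (pairLaw pX pU k z).toReal / ((pX z.1).toReal * (userLaw pX pU k z.2).toReal) =
    (pU k z.1 z.2).toReal / (userLaw pX pU k z.2).toReal by rw [hz]; field_simp]
  rw [Real.logb, Real.logb, Real.log_div hu hv, Real.log_div hv (by positivity), Real.log_inv]
  ring

end Marginals

/-! ### Counting codebooks by surjective additive maps -/

section Counting

/-- All fibres are cosets of the kernel: a surjective homomorphism carries the uniform law to the
uniform law. Every independence claim about codewords thereby reduces to a surjectivity claim. -/
theorem card_preimage_mul_card {A B : Type*} [AddGroup A] [AddGroup B] [Fintype A] [Fintype B]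
    [DecidableEq B] (φ : A →+ B) (hφ : Function.Surjective φ) (S : Finset B) :
    (Finset.univ.filter fun a => φ a ∈ S).card * Fintype.card B = S.card * Fintype.card A := by
  have h : ∀ S : Finset B, (Finset.univ.filter fun a => φ a ∈ S).card =
      S.card * (Finset.univ.filter fun a => φ a = 0).card := by
    intro S
    rw [Finset.card_eq_sum_card_fiberwise (f := φ) (t := S) (fun a ha => by simpa using ha),
      Finset.sum_const_nat]
    intro b hb
    rw [Finset.filter_filter, AddMonoidHom.card_fiber_eq_of_mem_range φ (hφ 0) (hφ b)]
    congr 1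
    ext a
    simp only [Finset.mem_filter, Finset.mem_univ, true_and]
    exact ⟨fun h => h.2, fun h => ⟨h ▸ hb, h⟩⟩
  have hA := h Finset.univ
  simp only [Finset.mem_univ, Finset.filter_true, Finset.card_univ] at hA
  rw [h S, hA]
  ring

theorem eq_of_digits_eq {q d l l' : ℕ} (hl : l < q ^ d) (hl' : l' < q ^ d)
    (h : ∀ i < d, l / q ^ i % q = l' / q ^ i % q) : l = l' := by
  have : ∀ j ≤ d, l % q ^ j = l' % q ^ j := by
    intro j
    induction j with
    | zero => simp [Nat.mod_one]
    | succ j ih =>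
      intro hj
      rw [Nat.mod_pow_succ, Nat.mod_pow_succ, ih (by omega), h j (by omega)]
  simpa [Nat.mod_eq_of_lt hl, Nat.mod_eq_of_lt hl'] using this d le_rfl

variable {F : Type*} [Field F] [Fintype F]

theorem numIndices_le_pow_numDigits (n : ℕ) (R : ℝ) :
    numIndices n R ≤ Fintype.card F ^ numDigits F n R := by
  have hq : (1 : ℝ) < Fintype.card F := by exact_mod_cast Fintype.one_lt_card
  have hlog : 0 < Real.logb 2 (Fintype.card F) := Real.logb_pos one_lt_two hq
  rw [numIndices, Nat.ceil_le, Nat.cast_pow]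
  have h1 : (n : ℝ) * R ≤ Real.logb 2 (Fintype.card F) * numDigits F n R := by
    rw [← div_le_iff₀' hlog]
    exact Nat.le_ceil _
  calc (2 : ℝ) ^ ((n : ℝ) * R) ≤ 2 ^ (Real.logb 2 (Fintype.card F) * numDigits F n R) :=
        Real.rpow_le_rpow_of_exponent_le one_le_two h1
    _ = _ := by
        rw [Real.rpow_mul zero_le_two, Real.rpow_logb two_pos (by norm_num) (by linarith),
          Real.rpow_natCast]

variable {K n : ℕ} {R : Fin K → ℝ} (e : Fin (Fintype.card F) ≃ F)

theorem expand_injective (k : Fin K) {l l' : Fin (numIndices n (R k))}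
    (h : expand e (numDigits F n (R k)) (maxDigits F n R) l =
      expand e (numDigits F n (R k)) (maxDigits F n R) l') : l = l' := by
  have hle := numIndices_le_pow_numDigits (F := F) n (R k)
  refine Fin.ext (eq_of_digits_eq (l.2.trans_le hle) (l'.2.trans_le hle) fun i hi => ?_)
  have hκ : numDigits F n (R k) ≤ maxDigits F n R :=
    Finset.le_sup (f := fun k => numDigits F n (R k)) (Finset.mem_univ k)
  have h1 := congrFun h ⟨i, hi.trans_le hκ⟩
  simpa [expand, hi] using h1

/-- Codewords as an additive function of the codebook. -/
noncomputable def codewordHom (k : Fin K) (l : Fin (numIndices n (R k))) :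
    Codebook F n R →+ (Fin n → F) where
  toFun c := codeword e c k l
  map_zero' := by simp [codeword]
  map_add' c c' := by
    simp only [codeword, Prod.fst_add, Prod.snd_add, Pi.add_apply, Matrix.vecMul_add]
    abel

/-- With `G = 0` the dithers already reach every tuple, so the shared generator matrix creates no
dependence across users at fixed indices. -/
theorem pi_codeword_surjective (l : (k : Fin K) → Fin (numIndices n (R k))) :
    Function.Surjective (AddMonoidHom.pi fun k => codewordHom (F := F) e k (l k)) := by
  intro y
  refine ⟨(0, y), ?_⟩
  ext k i
  simp [codewordHom, codeword]

theorem codewordHom_surjective (k : Fin K) (l : Fin (numIndices n (R k))) :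
    Function.Surjective (codewordHom (F := F) e k l) := by
  intro y
  refine ⟨(0, fun _ => y), ?_⟩
  ext i
  simp [codewordHom, codeword]

/-- The two codewords share a dither, so their difference must come from `G`. The expansions differ
in some digit i; a matrix supported on row i, scaled by the inverse of that digit difference,
produces any difference, and the dither then adjusts the first codeword. -/
theorem prod_codeword_surjective (k : Fin K) {l l' : Fin (numIndices n (R k))} (hl : l ≠ l') :
    Function.Surjective ((codewordHom (F := F) e k l).prod (codewordHom e k l')) := by
  rintro ⟨y, y'⟩
  set a := expand e (numDigits F n (R k)) (maxDigits F n R) l with ha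
  set a' := expand e (numDigits F n (R k)) (maxDigits F n R) l' with ha'
  obtain ⟨i, hi⟩ : ∃ i, a i ≠ a' i := by
    by_contra! hc
    exact hl (expand_injective e k (funext hc))
  have hi' : a i - a' i ≠ 0 := sub_ne_zero.mpr hi
  let G : Matrix (Fin (maxDigits F n R)) (Fin n) F :=
    Matrix.of fun j m => if j = i then (a i - a' i)⁻¹ * (y m - y' m) else 0
  have hG : ∀ b : Fin (maxDigits F n R) → F, ∀ m,
      Matrix.vecMul b G m = b i * ((a i - a' i)⁻¹ * (y m - y' m)) := by
    intro b m
    simp [Matrix.vecMul, dotProduct, G]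
  refine ⟨(G, fun _ => y - Matrix.vecMul a G), ?_⟩
  refine Prod.ext ?_ ?_
  · simp [codewordHom, codeword, ← ha]
  · ext m
    simp only [AddMonoidHom.prod_apply, codewordHom, codeword, AddMonoidHom.coe_mk, ZeroHom.coe_mk,
      ← ha', Pi.add_apply, Pi.sub_apply, hG]
    field_simp
    ring

-- The count is a sum of pairwise independent indicators, so its variance is at most its mean:
-- off-diagonal covariances vanish and each diagonal one is at most `p`.
open Classical in
theorem sum_card_sub_sq_le (k : Fin K) (T : Finset (Fin n → F)) :
    ∑ c : Codebook F n R,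
      (((Finset.univ.filter fun l => codeword e c k l ∈ T).card : ℝ) -
        numIndices n (R k) * (T.card / Fintype.card (Fin n → F))) ^ 2 ≤
    Fintype.card (Codebook F n R) *
      (numIndices n (R k) * (T.card / Fintype.card (Fin n → F))) := by
  set Q : ℝ := (Fintype.card (Fin n → F) : ℝ) with hQ
  have hQ0 : Q ≠ 0 := by rw [hQ]; exact_mod_cast Fintype.card_ne_zero
  set p : ℝ := T.card / Q with hp
  set C : ℝ := (Fintype.card (Codebook F n R) : ℝ) with hC
  let f : Codebook F n R → Fin (numIndices n (R k)) → ℝ := fun c l =>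
    if codeword e c k l ∈ T then 1 else 0
  have hsingle : ∀ l, ∑ c, f c l = C * p := by
    intro l
    have h := card_preimage_mul_card (codewordHom (R := R) e k l) (codewordHom_surjective e k l) T
    simp only [f, Finset.sum_boole]
    rw [hp, mul_div_assoc', eq_div_iff hQ0, mul_comm C, hQ, hC]
    exact_mod_cast h
  have hpair : ∀ l l', l ≠ l' → ∑ c, f c l * f c l' = C * p ^ 2 := by
    intro l l' hl
    have h := card_preimage_mul_card ((codewordHom (R := R) e k l).prod (codewordHom e k l'))
      (prod_codeword_surjective e k hl) (T ×ˢ T)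
    have h1 : ∑ c, f c l * f c l' = ((Finset.univ.filter fun c =>
        ((codewordHom (R := R) e k l).prod (codewordHom e k l')) c ∈ T ×ˢ T).card : ℝ) := by
      rw [← Finset.sum_boole]
      refine Finset.sum_congr rfl fun c _ => ?_
      simp only [f, ite_zero_mul_ite_zero, mul_one, Finset.mem_product]
      rfl
    rw [Fintype.card_prod, Finset.card_product] at h
    rw [h1, hp, div_pow, mul_div_assoc', eq_div_iff (pow_ne_zero 2 hQ0), mul_comm C, sq, sq, hQ, hC]
    exact_mod_cast h
  have hcov : ∀ l l', ∑ c, (f c l - p) * (f c l' - p) ≤ if l = l' then C * p else 0 := by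
    intro l l'
    have h1 : ∑ c, (f c l - p) * (f c l' - p) =
        ∑ c, f c l * f c l' - (∑ c, f c l) * p - p * (∑ c, f c l') + C * p ^ 2 := by
      rw [hC, ← nsmul_eq_mul, ← Finset.card_univ, ← Finset.sum_const, Finset.sum_mul,
        Finset.mul_sum, ← Finset.sum_sub_distrib, ← Finset.sum_sub_distrib,
        ← Finset.sum_add_distrib]
      exact Finset.sum_congr rfl fun c _ => by ring
    rw [h1, hsingle, hsingle]
    split_ifs with hl
    · subst hl
      have h2 : ∑ c, f c l * f c l = C * p := by
        rw [← hsingle l]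
        exact Finset.sum_congr rfl fun c _ => by simp [f]
      rw [h2]
      have : 0 ≤ C * p ^ 2 := by positivity
      nlinarith
    · rw [hpair l l' hl]
      exact le_of_eq (by ring)
  calc _ = ∑ c : Codebook F n R, ∑ l, ∑ l', (f c l - p) * (f c l' - p) := by
        refine Finset.sum_congr rfl fun c _ => ?_
        rw [← Finset.sum_mul_sum, ← sq, Finset.sum_sub_distrib]
        simp [f]
    _ = ∑ l, ∑ l', ∑ c : Codebook F n R, (f c l - p) * (f c l' - p) := by
        rw [Finset.sum_comm]
        exact Finset.sum_congr rfl fun l _ => Finset.sum_comm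
    _ ≤ ∑ l : Fin (numIndices n (R k)), ∑ l' : Fin (numIndices n (R k)),
          if l = l' then C * p else 0 :=
        Finset.sum_le_sum fun l _ => Finset.sum_le_sum fun l' _ => hcov l l'
    _ = _ := by
        simp
        ring

open Classical in
/-- Chebyshev's inequality for the number of codewords in `T`. -/
theorem card_few_codewords_le (k : Fin K) (T : Finset (Fin n → F)) {E : ℝ} (hE0 : 0 < E)
    (hE : E = numIndices n (R k) * (T.card / Fintype.card (Fin n → F))) :
    ((Finset.univ.filter fun c : Codebook F n R =>
        ((Finset.univ.filter fun l => codeword e c k l ∈ T).card : ℝ) < E / 2).card : ℝ) ≤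
      Fintype.card (Codebook F n R) * (4 / E) := by
  have h := sum_card_sub_sq_le (R := R) e k T
  rw [← hE] at h
  have h1 : ((Finset.univ.filter fun c : Codebook F n R =>
        ((Finset.univ.filter fun l => codeword e c k l ∈ T).card : ℝ) < E / 2).card : ℝ) *
      (E ^ 2 / 4) ≤ ∑ c : Codebook F n R,
      (((Finset.univ.filter fun l => codeword e c k l ∈ T).card : ℝ) - E) ^ 2 := by
    rw [← nsmul_eq_mul, ← Finset.sum_const, Finset.sum_filter]
    refine Finset.sum_le_sum fun c _ => ?_
    split_ifs with hc
    · nlinarith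
    · positivity
  have h2 := h1.trans h
  rw [← le_div_iff₀ (by positivity)] at h2
  refine h2.trans (le_of_eq ?_)
  field_simp

-- Linearity of expectation: for each fixed index tuple the codewords are jointly uniform. Nothing
-- is needed about how different index tuples interact.
open Classical in
theorem sum_card_tuples_eq (B : Finset (Fin K → Fin n → F)) :
    ∑ c : Codebook F n R, ((Finset.univ.filter fun l : (k : Fin K) → Fin (numIndices n (R k)) =>
      (fun k => codeword e c k (l k)) ∈ B).card : ℝ) =
    Fintype.card (Codebook F n R) * (B.card *
      ∏ k, ((numIndices n (R k) : ℝ) / Fintype.card (Fin n → F))) := by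
  have hQ0 : (Fintype.card (Fin n → F) : ℝ) ≠ 0 := by exact_mod_cast Fintype.card_ne_zero
  have hl : ∀ l : (k : Fin K) → Fin (numIndices n (R k)),
      (∑ c : Codebook F n R, if (fun k => codeword e c k (l k)) ∈ B then (1 : ℝ) else 0) =
        B.card * Fintype.card (Codebook F n R) / (Fintype.card (Fin n → F) : ℝ) ^ K := by
    intro l
    have h := card_preimage_mul_card _ (pi_codeword_surjective (R := R) e l) B
    rw [Finset.sum_boole, eq_div_iff (pow_ne_zero _ hQ0)]
    have h2 : Fintype.card (Fin K → Fin n → F) = Fintype.card (Fin n → F) ^ K := by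
      rw [Fintype.card_fun, Fintype.card_fin]
    rw [h2] at h
    exact_mod_cast h
  simp_rw [← Finset.sum_boole]
  rw [Finset.sum_comm, Finset.sum_congr rfl fun l _ => hl l, Finset.sum_const, Finset.card_univ,
    Fintype.card_pi, nsmul_eq_mul, Finset.prod_div_distrib]
  simp
  field_simp

end Counting

/-! ### Error probability for a fixed `x` -/

section Error

variable {𝒳 F : Type*} [Fintype 𝒳] [Field F] [Fintype F] {K n : ℕ} {R : Fin K → ℝ}

open Classical in
theorem probJointlyTypical_eq (pX : PMF 𝒳) (pU : Fin K → 𝒳 → PMF F)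
    (e : Fin (Fintype.card F) ≃ F) (ε ε' : ℝ) (x : Fin n → 𝒳) :
    probJointlyTypical pX pU e ε ε' R x = ∑ c : Codebook F n R,
      (Fintype.card (Codebook F n R) : ℝ)⁻¹ *
        (((Fintype.piFinset (candidates pX pU e ε' x c)).filter fun l =>
            (fun i => (x i, fun k => codeword e c k (l k) i)) ∈
              typicalSet (jointLaw pX pU) ε n).card /
          (Fintype.piFinset (candidates pX pU e ε' x c)).card) := by
  rw [probJointlyTypical, encodingLaw, PMF.toOuterMeasure_bind_apply, tsum_fintype,
    ENNReal.toReal_sum]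
  · refine Finset.sum_congr rfl fun c _ => ?_
    rw [PMF.toOuterMeasure_map_apply, PMF.toOuterMeasure_uniformOfFinset_apply,
      PMF.uniformOfFintype_apply, ENNReal.toReal_mul, ENNReal.toReal_inv, ENNReal.toReal_div]
    simp
  · intro c _
    refine ENNReal.mul_ne_top (PMF.apply_ne_top _ _) ?_
    rw [PMF.toOuterMeasure_map_apply, PMF.toOuterMeasure_uniformOfFinset_apply]
    refine ENNReal.div_ne_top (by simp) ?_
    have := Fintype.piFinset_nonempty.mpr (candidates_nonempty pX pU e ε' x c)
    exact_mod_cast (Finset.card_pos.mpr this).ne'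

open Classical in
/-- The sequences `uⁿ` with `(xⁿ, uⁿ)` typical. -/
noncomputable def condTypical {V : Type*} [Fintype V] (r : PMF (𝒳 × V)) (ε : ℝ) (x : Fin n → 𝒳) :
    Finset (Fin n → V) :=
  Finset.univ.filter fun u => (fun i => (x i, u i)) ∈ typicalSet r ε n

open Classical in
/-- The tuples of individually typical sequences that are not jointly typical. -/
noncomputable def badTuples (pX : PMF 𝒳) (pU : Fin K → 𝒳 → PMF F) (ε ε' : ℝ) (x : Fin n → 𝒳) :
    Finset (Fin K → Fin n → F) :=
  Finset.univ.filter fun u => (∀ k, u k ∈ condTypical (pairLaw pX pU k) ε' x) ∧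
    (fun i => (x i, fun k => u k i)) ∉ typicalSet (jointLaw pX pU) ε n

/-- The first sum is Chebyshev's bound on some user having too few typical codewords. Otherwise the
indices are uniform on a product of sets of size at least E_k/2, so the error is at most the count
of bad index tuples times ∏ 2/E_k, and averaging over codebooks cancels the numbers of indices. -/
theorem one_sub_probJointlyTypical_le (pX : PMF 𝒳) (pU : Fin K → 𝒳 → PMF F)
    (e : Fin (Fintype.card F) ≃ F) (ε ε' : ℝ) (x : Fin n → 𝒳)
    (hT : ∀ k, 0 < (condTypical (pairLaw pX pU k) ε' x).card) :
    1 - probJointlyTypical pX pU e ε ε' R x ≤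
      ∑ k, 4 / (numIndices n (R k) *
        ((condTypical (pairLaw pX pU k) ε' x).card / (Fintype.card F : ℝ) ^ n)) +
      (badTuples pX pU ε ε' x).card *
        ∏ k, (2 / ((condTypical (pairLaw pX pU k) ε' x).card : ℝ)) := by
  classical
  have hqn : (Fintype.card F : ℝ) ^ n = Fintype.card (Fin n → F) := by
    rw [Fintype.card_fun, Fintype.card_fin, Nat.cast_pow]
  rw [hqn]
  have hq0 : (0 : ℝ) < Fintype.card (Fin n → F) := by exact_mod_cast Fintype.card_pos
  set T := fun k => condTypical (pairLaw pX pU k) ε' x with hTdef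
  set B := badTuples pX pU ε ε' x with hB
  set E : Fin K → ℝ := fun k => numIndices n (R k) * ((T k).card / Fintype.card (Fin n → F)) with hE
  have hM : ∀ k, (0 : ℝ) < numIndices n (R k) := fun k => by exact_mod_cast numIndices_pos n (R k)
  have hT' : ∀ k, (0 : ℝ) < (T k).card := fun k => by exact_mod_cast hT k
  have hE0 : ∀ k, 0 < E k := fun k => mul_pos (hM k) (div_pos (hT' k) hq0)
  set C : ℝ := (Fintype.card (Codebook F n R) : ℝ) with hC
  have hC0 : 0 < C := by rw [hC]; exact_mod_cast Fintype.card_pos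
  let P : Codebook F n R → Finset ((k : Fin K) → Fin (numIndices n (R k))) := fun c =>
    Fintype.piFinset (candidates pX pU e ε' x c)
  let typ : Codebook F n R → ((k : Fin K) → Fin (numIndices n (R k))) → Prop := fun c l =>
    (fun i => (x i, fun k => codeword e c k (l k) i)) ∈ typicalSet (jointLaw pX pU) ε n
  have hP : ∀ c, (0 : ℝ) < (P c).card := fun c => by
    exact_mod_cast Finset.card_pos.mpr
      (Fintype.piFinset_nonempty.mpr (candidates_nonempty pX pU e ε' x c))
  have herr : 1 - probJointlyTypical pX pU e ε ε' R x =
      ∑ c, C⁻¹ * (((P c).filter fun l => ¬ typ c l).card / (P c).card) := by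
    have h1 : (1 : ℝ) = ∑ _c : Codebook F n R, C⁻¹ := by
      rw [Finset.sum_const, Finset.card_univ, nsmul_eq_mul, ← hC, mul_inv_cancel₀ hC0.ne']
    rw [probJointlyTypical_eq]
    nth_rewrite 1 [h1]
    rw [← Finset.sum_sub_distrib]
    refine Finset.sum_congr rfl fun c _ => ?_
    have h2 : (((P c).filter fun l => typ c l).card : ℝ) +
        ((P c).filter fun l => ¬ typ c l).card = (P c).card := by
      exact_mod_cast Finset.card_filter_add_card_filter_not (s := P c) (typ c)
    have h3 : (((P c).filter fun l => ¬ typ c l).card : ℝ) =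
        (P c).card - ((P c).filter fun l => typ c l).card := by linarith
    rw [h3, sub_div, div_self (hP c).ne', mul_sub, mul_one]
  have hNT : ∀ (c : Codebook F n R) k, typicalIndices pX pU e ε' x c k =
      Finset.univ.filter fun l => codeword e c k l ∈ T k := by
    intro c k
    ext l
    simp [typicalIndices, hTdef, condTypical]
  have hpt : ∀ c : Codebook F n R, (((P c).filter fun l => ¬ typ c l).card : ℝ) / (P c).card ≤
      (∑ k, if ((Finset.univ.filter fun l => codeword e c k l ∈ T k).card : ℝ) < E k / 2
        then (1 : ℝ) else 0) +
      ((Finset.univ.filter fun l : (k : Fin K) → Fin (numIndices n (R k)) =>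
        (fun k => codeword e c k (l k)) ∈ B).card : ℝ) * ∏ k, (2 / E k) := by
    intro c
    have hprod : 0 ≤ ∏ k, (2 / E k) := Finset.prod_nonneg fun k _ => by have := hE0 k; positivity
    by_cases hgood : ∃ k, ((Finset.univ.filter fun l => codeword e c k l ∈ T k).card : ℝ) < E k / 2
    · obtain ⟨k, hk⟩ := hgood
      have h1 : (((P c).filter fun l => ¬ typ c l).card : ℝ) / (P c).card ≤ 1 :=
        div_le_one_of_le₀ (by exact_mod_cast Finset.card_filter_le _ _) (hP c).le
      have h2 := Finset.single_le_sum (f := fun k =>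
        if ((Finset.univ.filter fun l => codeword e c k l ∈ T k).card : ℝ) < E k / 2
          then (1 : ℝ) else 0) (fun k _ => by positivity) (Finset.mem_univ k)
      simp only [if_pos hk] at h2
      have h3 := mul_nonneg (Nat.cast_nonneg (α := ℝ) (Finset.univ.filter fun l :
        (k : Fin K) → Fin (numIndices n (R k)) => (fun k => codeword e c k (l k)) ∈ B).card) hprod
      linarith
    · push Not at hgood
      -- Here at least E_k/2 > 0 codewords are typical, so the fallback to all indices never occurs.
      have hcand : ∀ k, candidates pX pU e ε' x c k =
          Finset.univ.filter fun l => codeword e c k l ∈ T k := by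
        intro k
        rw [candidates, if_pos, hNT]
        rw [hNT, ← Finset.card_pos]
        have := hgood k
        have := hE0 k
        exact_mod_cast (by linarith :
          (0 : ℝ) < (Finset.univ.filter fun l => codeword e c k l ∈ T k).card)
      have h1 : (((P c).filter fun l => ¬ typ c l).card : ℝ) ≤
          (Finset.univ.filter fun l : (k : Fin K) → Fin (numIndices n (R k)) =>
            (fun k => codeword e c k (l k)) ∈ B).card := by
        norm_cast
        refine Finset.card_le_card fun l hl => ?_
        simp only [P, Finset.mem_filter, Fintype.mem_piFinset, hcand, Finset.mem_univ, true_and,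
          hB, badTuples] at hl ⊢
        exact hl
      have h2 : (1 : ℝ) / (P c).card ≤ ∏ k, (2 / E k) := by
        rw [Fintype.card_piFinset, Nat.cast_prod, one_div, ← Finset.prod_inv_distrib]
        refine Finset.prod_le_prod (fun k _ => by positivity) fun k _ => ?_
        rw [hcand, ← inv_div]
        exact inv_anti₀ (half_pos (hE0 k)) (hgood k)
      have h4 : (0 : ℝ) ≤ ∑ k, if ((Finset.univ.filter fun l =>
          codeword e c k l ∈ T k).card : ℝ) < E k / 2 then (1 : ℝ) else 0 :=
        Finset.sum_nonneg fun k _ => by positivity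
      rw [div_eq_mul_one_div]
      have h5 := mul_le_mul h1 h2 (by positivity) (Nat.cast_nonneg _)
      linarith
  calc _ = _ := herr
    _ ≤ ∑ c, C⁻¹ * ((∑ k, if ((Finset.univ.filter fun l => codeword e c k l ∈ T k).card : ℝ) <
          E k / 2 then (1 : ℝ) else 0) +
        ((Finset.univ.filter fun l : (k : Fin K) → Fin (numIndices n (R k)) =>
          (fun k => codeword e c k (l k)) ∈ B).card : ℝ) * ∏ k, (2 / E k)) :=
        Finset.sum_le_sum fun c _ => mul_le_mul_of_nonneg_left (hpt c) (by positivity)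
    _ = C⁻¹ * (∑ k, ((Finset.univ.filter fun c : Codebook F n R =>
          ((Finset.univ.filter fun l => codeword e c k l ∈ T k).card : ℝ) < E k / 2).card : ℝ)) +
        C⁻¹ * (C * (B.card * ∏ k, ((numIndices n (R k) : ℝ) / Fintype.card (Fin n → F)))) *
          ∏ k, (2 / E k) := by
        rw [← Finset.mul_sum, Finset.sum_add_distrib, ← Finset.sum_mul, sum_card_tuples_eq,
          Finset.sum_comm, mul_add]
        simp only [Finset.sum_boole]
        ring
    _ ≤ C⁻¹ * (∑ k, C * (4 / E k)) +
        C⁻¹ * (C * (B.card * ∏ k, ((numIndices n (R k) : ℝ) / Fintype.card (Fin n → F)))) *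
          ∏ k, (2 / E k) := by
        gcongr with k
        exact card_few_codewords_le e k (T k) (hE0 k) rfl
    _ = _ := by
        rw [← Finset.mul_sum, inv_mul_cancel_left₀ hC0.ne', inv_mul_cancel_left₀ hC0.ne', mul_assoc,
          ← Finset.prod_mul_distrib]
        congr 2
        refine Finset.prod_congr rfl fun k _ => ?_
        have h1 := (hM k).ne'
        have h2 := (hT' k).ne'
        change _ = 2 / ((T k).card : ℝ)
        simp only [hE]
        field_simp

end Error

/-! ### Exponential sizes of the typical and bad sets -/

section Sizes

variable {𝒳 : Type*} [Fintype 𝒳] {n : ℕ}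

-- Typical sequences carry at least half of the total weight 1, and each weighs at most
-- exp(-n(1-ε)H).
open Classical in
theorem half_exp_le_card_condTypical {V : Type*} [Fintype V] (p : PMF 𝒳) (w : 𝒳 → V → ℝ)
    (r : PMF (𝒳 × V)) (hw0 : ∀ a v, 0 ≤ w a v) (hw1 : ∀ a, ∑ v, w a v = 1)
    (hr : ∀ a v, (r (a, v)).toReal = (p a).toReal * w a v) {ε : ℝ} (hn : 0 < n) (x : Fin n → 𝒳)
    (h : ∑ u : Fin n → V with (fun i => (x i, u i)) ∉ typicalSet r ε n,
      ∏ i, w (x i) (u i) ≤ 1 / 2) :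
    1 / 2 * Real.exp (n * ((1 - ε) * condEntropy p w)) ≤ (condTypical r ε x).card := by
  have htot : ∑ u : Fin n → V, ∏ i, w (x i) (u i) = 1 := by
    rw [← Fintype.prod_sum fun i v => w (x i) v]
    simp [hw1]
  have hsplit := Finset.sum_filter_add_sum_filter_not Finset.univ
    (fun u : Fin n → V => (fun i => (x i, u i)) ∈ typicalSet r ε n) fun u => ∏ i, w (x i) (u i)
  have hle : ∑ u : Fin n → V with (fun i => (x i, u i)) ∈ typicalSet r ε n, ∏ i, w (x i) (u i) ≤
      (condTypical r ε x).card * Real.exp (-(n * ((1 - ε) * condEntropy p w))) := by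
    rw [← nsmul_eq_mul, condTypical]
    refine Finset.sum_le_card_nsmul _ _ _ fun u hu => ?_
    exact (weight_bounds_of_mem_typicalSet p w r hw0 hw1 hr hn (Finset.mem_filter.mp hu).2).2
  rw [Real.exp_neg, ← div_eq_mul_inv] at hle
  rw [← le_div_iff₀ (Real.exp_pos _)]
  linarith

variable {F : Type*} [Fintype F] {K : ℕ}

-- Conditional independence makes the weight of a tuple the product of its users' weights, so
-- individual typicality alone bounds it below by exp(-n(1+ε')S). All bad tuples together weigh no
-- more than the jointly atypical event.
open Classical in
theorem card_badTuples_le (pX : PMF 𝒳) (pU : Fin K → 𝒳 → PMF F) (ε ε' : ℝ) (hn : 0 < n)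
    (x : Fin n → 𝒳) :
    ((badTuples pX pU ε ε' x).card : ℝ) ≤
      (∑ v : Fin n → Fin K → F with (fun i => (x i, v i)) ∉ typicalSet (jointLaw pX pU) ε n,
        ∏ i, ∏ k, (pU k (x i) (v i k)).toReal) *
      Real.exp (n * ((1 + ε') * ∑ k, condEntropy pX fun a v => (pU k a v).toReal)) := by
  set H : Fin K → ℝ := fun k => condEntropy pX fun a v => (pU k a v).toReal with hH
  have hlow : ∀ u ∈ badTuples pX pU ε ε' x, Real.exp (-(n * ((1 + ε') * ∑ k, H k))) ≤
      ∏ k, ∏ i, (pU k (x i) (u k i)).toReal := by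
    intro u hu
    have h1 : Real.exp (-(n * ((1 + ε') * ∑ k, H k))) =
        ∏ k, Real.exp (-(n * ((1 + ε') * H k))) := by
      rw [← Real.exp_sum, Finset.sum_neg_distrib, Finset.mul_sum, Finset.mul_sum]
    rw [h1]
    refine Finset.prod_le_prod (fun k _ => (Real.exp_pos _).le) fun k _ => ?_
    refine (weight_bounds_of_mem_typicalSet pX (fun a v => (pU k a v).toReal) (pairLaw pX pU k)
      (fun _ _ => ENNReal.toReal_nonneg) (fun a => pmf_sum_toReal _) (fun a v => ?_) hn ?_).1
    · rw [pairLaw_apply, ENNReal.toReal_mul]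
    · exact (Finset.mem_filter.mp ((Finset.mem_filter.mp hu).2.1 k)).2
  have hsum : ((badTuples pX pU ε ε' x).card : ℝ) * Real.exp (-(n * ((1 + ε') * ∑ k, H k))) ≤
      ∑ v : Fin n → Fin K → F with (fun i => (x i, v i)) ∉ typicalSet (jointLaw pX pU) ε n,
        ∏ i, ∏ k, (pU k (x i) (v i k)).toReal := by
    calc _ ≤ ∑ u ∈ badTuples pX pU ε ε' x, ∏ k, ∏ i, (pU k (x i) (u k i)).toReal := by
          rw [← nsmul_eq_mul]
          exact Finset.card_nsmul_le_sum _ _ _ hlow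
      _ ≤ ∑ u : Fin K → Fin n → F with
            (fun i => (x i, fun k => u k i)) ∉ typicalSet (jointLaw pX pU) ε n,
            ∏ k, ∏ i, (pU k (x i) (u k i)).toReal := by
          refine Finset.sum_le_sum_of_subset_of_nonneg (fun u hu => ?_) fun u _ _ =>
            Finset.prod_nonneg fun k _ => Finset.prod_nonneg fun i _ => ENNReal.toReal_nonneg
          exact Finset.mem_filter.mpr ⟨Finset.mem_univ _, (Finset.mem_filter.mp hu).2.2⟩
      _ = _ := by
          rw [Finset.sum_filter, Finset.sum_filter]
          refine Fintype.sum_equiv (Equiv.piComm fun _ _ => F) _ _ fun u => ?_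
          rw [Finset.prod_comm]
          rfl
  rwa [Real.exp_neg, ← div_eq_mul_inv, div_le_iff₀ (Real.exp_pos _)] at hsum

theorem exp_le_numIndices (n : ℕ) (R : ℝ) : Real.exp (n * (R * Real.log 2)) ≤ numIndices n R := by
  refine le_trans (le_of_eq ?_) (Nat.le_ceil _)
  rw [Real.rpow_def_of_pos two_pos]
  ring_nf

theorem tendsto_mul_exp_neg_nat_mul (a : ℝ) {c : ℝ} (hc : 0 < c) :
    Tendsto (fun n : ℕ => a * Real.exp (-(n * c))) atTop (𝓝 0) := by
  rw [← mul_zero a]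
  refine Tendsto.const_mul a (Real.tendsto_exp_neg_atTop_nhds_zero.comp ?_)
  exact tendsto_natCast_atTop_atTop.atTop_mul_const hc

end Sizes

end NestedLinear

/-! ### Choice of constants and conclusion -/

open NestedLinear in
theorem mainTheorem5 {𝒳 F : Type*} [Fintype 𝒳] [Field F] [Fintype F] {K : ℕ}
    (pX : PMF 𝒳) (pU : Fin K → 𝒳 → PMF F) :
    ∃ δ : ℝ → ℝ, (∀ t, 0 < t → 0 < δ t) ∧ Tendsto δ (𝓝[>] 0) (𝓝 0) ∧
      ∀ ε : ℝ, 0 < ε → ε < 1 → ∃ ε₀ : ℝ, 0 < ε₀ ∧ ε₀ ≤ ε ∧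
        ∀ ε' ε'' : ℝ, 0 < ε'' → ε'' < ε' → ε' < ε₀ →
          ∀ R : Fin K → ℝ,
            (∀ k, R k > NestedLinear.mutualInfo (NestedLinear.pairLaw pX pU k)
              + NestedLinear.relEntropy (NestedLinear.userLaw pX pU k) (PMF.uniformOfFintype F)
              + δ ε') →
            ∀ e : Fin (Fintype.card F) ≃ F, ∀ η : ℝ, 0 < η →
              ∀ᶠ n : ℕ in atTop, ∀ x ∈ NestedLinear.typicalSet pX ε'' n,
                1 - η ≤ NestedLinear.probJointlyTypical pX pU e ε ε' R x := by
  classical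
  have hlog2 : 0 < Real.log 2 := Real.log_pos one_lt_two
  set w : Fin K → 𝒳 → F → ℝ := fun k a v => (pU k a v).toReal with hw
  have hw0 : ∀ k a v, 0 ≤ w k a v := fun _ _ _ => ENNReal.toReal_nonneg
  have hw1 : ∀ k a, ∑ v, w k a v = 1 := fun k a => pmf_sum_toReal _
  have hr : ∀ k a v, (pairLaw pX pU k (a, v)).toReal = (pX a).toReal * w k a v := fun k a v => by
    rw [pairLaw_apply, ENNReal.toReal_mul]
  set H : Fin K → ℝ := fun k => condEntropy pX (w k) with hH
  have hH0 : ∀ k, 0 ≤ H k := fun k => condEntropy_nonneg pX (w k) (hw0 k) (hw1 k)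
  set S : ℝ := ∑ k, H k with hS
  have hS0 : 0 ≤ S := Finset.sum_nonneg fun k _ => hH0 k
  have hHS : ∀ k, H k ≤ S := fun k =>
    Finset.single_le_sum (fun k _ => hH0 k) (Finset.mem_univ k)
  -- The part S t / log 2 pays, in bits, for the loss ε' H_k ≤ ε' S in the exponent of |T_k|; the
  -- extra t is the exponent left for the growth of E_k.
  refine ⟨fun t => (S / Real.log 2 + 1) * t, fun t ht => by positivity, ?_, ?_⟩
  · refine Tendsto.mono_left ?_ nhdsWithin_le_nhds
    exact Continuous.tendsto' (by fun_prop) _ _ (by simp)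
  intro ε hε _
  obtain ⟨cJ, hcJ, hJ⟩ := exists_atypical_weight_le pX (fun a v => ∏ k, w k a (v k))
    (jointLaw pX pU) (fun a v => Finset.prod_nonneg fun k _ => hw0 k _ _)
    (fun a => by rw [← Fintype.prod_sum fun k v => w k a v]; simp [hw1])
    (fun a v => jointLaw_toReal pX pU a v) (half_pos hε)
  -- The bound ε/2 leaves the gap ε/2 used for `cJ`; the other gives 2ε'S ≤ cJ/2. The summand 1
  -- covers S = 0.
  refine ⟨min (ε / 2) (cJ / (4 * (S + 1))), by positivity, (min_le_left _ _).trans (by linarith), ?_⟩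
  intro ε' ε'' hε''0 hε'' hε' R hR e η hη
  have hε'0 : 0 < ε' := hε''0.trans hε''
  have hεh : ε' < ε / 2 := hε'.trans_le (min_le_left _ _)
  have hεS : 2 * ε' * S ≤ cJ / 2 := by
    have h := (hε'.trans_le (min_le_right _ _)).le
    rw [le_div_iff₀ (by positivity)] at h
    nlinarith
  -- Single-user typicality has only the gap ε' - ε'', so these exponents may be tiny; they affect
  -- only how large `n` must be.
  choose ck hck0 hck using fun k => exists_atypical_weight_le pX (w k) (pairLaw pX pU k) (hw0 k)
    (hw1 k) (hr k) (sub_pos.mpr hε'')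
  set A : ℝ := 2 * Fintype.card (𝒳 × (Fin K → F)) with hA
  have hev1 : ∀ᶠ n : ℕ in atTop, ∀ k,
      2 * Fintype.card (𝒳 × F) * Real.exp (-(n * ck k)) ≤ 1 / 2 :=
    eventually_all.mpr fun k =>
      (tendsto_mul_exp_neg_nat_mul _ (hck0 k)).eventually_le_const (by norm_num)
  have hev2 : ∀ᶠ n : ℕ in atTop, K * 8 * Real.exp (-(n * (ε' * Real.log 2))) ≤ η / 2 :=
    (tendsto_mul_exp_neg_nat_mul _ (by positivity)).eventually_le_const (by positivity)
  have hev3 : ∀ᶠ n : ℕ in atTop, A * 4 ^ K * Real.exp (-(n * (cJ / 2))) ≤ η / 2 :=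
    (tendsto_mul_exp_neg_nat_mul _ (by positivity)).eventually_le_const (by positivity)
  filter_upwards [hev1, hev2, hev3, eventually_gt_atTop 0] with n h1 h2 h3 hn x hx
  have hT : ∀ k, 1 / 2 * Real.exp (n * ((1 - ε') * H k)) ≤
      (condTypical (pairLaw pX pU k) ε' x).card := fun k =>
    half_exp_le_card_condTypical pX (w k) _ (hw0 k) (hw1 k) (hr k) hn x
      ((hck k ε' ε'' (by linarith) n hn x hx).trans (h1 k))
  have hT0 : ∀ k, 0 < (condTypical (pairLaw pX pU k) ε' x).card := fun k => by
    exact_mod_cast (lt_of_lt_of_le (by positivity) (hT k) :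
      (0 : ℝ) < (condTypical (pairLaw pX pU k) ε' x).card)
  have hq : (0 : ℝ) < Fintype.card F := by exact_mod_cast Fintype.card_pos
  have hfew : ∀ k, 4 / (numIndices n (R k) *
      ((condTypical (pairLaw pX pU k) ε' x).card / (Fintype.card F : ℝ) ^ n)) ≤
      8 * Real.exp (-(n * (ε' * Real.log 2))) := by
    intro k
    have hRk : Real.log (Fintype.card F) - H k + S * ε' + ε' * Real.log 2 ≤ R k * Real.log 2 := by
      have h := (hR k).le
      rw [mutualInfo_add_relEntropy] at h
      have h' := mul_le_mul_of_nonneg_right h hlog2.le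
      refine le_trans (le_of_eq ?_) h'
      simp only [hH, hw]
      field_simp
      ring
    have hqn : (Fintype.card F : ℝ) ^ n = Real.exp (n * Real.log (Fintype.card F)) := by
      rw [Real.exp_nat_mul, Real.exp_log hq]
    have hE : 1 / 2 * Real.exp (n * (ε' * Real.log 2)) ≤ numIndices n (R k) *
        ((condTypical (pairLaw pX pU k) ε' x).card / (Fintype.card F : ℝ) ^ n) := by
      calc 1 / 2 * Real.exp (n * (ε' * Real.log 2)) ≤
          1 / 2 * Real.exp (n * (R k * Real.log 2 + (1 - ε') * H k -
            Real.log (Fintype.card F))) := by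
            gcongr
            nlinarith [mul_le_mul_of_nonneg_right (hHS k) hε'0.le]
        _ = Real.exp (n * (R k * Real.log 2)) * ((1 / 2 * Real.exp (n * ((1 - ε') * H k))) /
              (Fintype.card F : ℝ) ^ n) := by
            rw [hqn, mul_sub, mul_add, Real.exp_sub, Real.exp_add]
            ring
        _ ≤ _ := by
            gcongr
            · exact exp_le_numIndices n (R k)
            · exact hT k
    rw [Real.exp_neg]
    refine (div_le_div_of_nonneg_left (by norm_num) (by positivity) hE).trans (le_of_eq ?_)
    field_simp
    norm_num
  have hbad : ((badTuples pX pU ε ε' x).card : ℝ) *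
      ∏ k, (2 / ((condTypical (pairLaw pX pU k) ε' x).card : ℝ)) ≤
      A * 4 ^ K * Real.exp (-(n * (cJ / 2))) := by
    have hB := (card_badTuples_le pX pU ε ε' hn x).trans
      (mul_le_mul_of_nonneg_right (hJ ε ε'' (by linarith) n hn x hx) (Real.exp_pos _).le)
    have hprod : ∏ k, (2 / ((condTypical (pairLaw pX pU k) ε' x).card : ℝ)) ≤
        4 ^ K * Real.exp (-(n * ((1 - ε') * S))) := by
      calc _ ≤ ∏ k, (4 * Real.exp (-(n * ((1 - ε') * H k)))) := by
            refine Finset.prod_le_prod (fun k _ => by positivity) fun k _ => ?_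
            rw [Real.exp_neg]
            refine (div_le_div_of_nonneg_left (by norm_num) (by positivity) (hT k)).trans
              (le_of_eq ?_)
            field_simp
            norm_num
        _ = _ := by
            rw [Finset.prod_mul_distrib, ← Real.exp_sum, Finset.sum_neg_distrib, hS,
              Finset.mul_sum, Finset.mul_sum]
            simp
    calc _ ≤ (A * Real.exp (-(n * cJ)) * Real.exp (n * ((1 + ε') * S))) *
          (4 ^ K * Real.exp (-(n * ((1 - ε') * S)))) :=
          mul_le_mul hB hprod (Finset.prod_nonneg fun k _ => by positivity) (by positivity)
      -- The entropy exponents cancel up to 2ε'S, which costs at most half of `cJ`.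
      _ = A * 4 ^ K * Real.exp (-(n * cJ) + n * ((1 + ε') * S) + -(n * ((1 - ε') * S))) := by
          rw [Real.exp_add, Real.exp_add]
          ring
      _ ≤ _ := by
          gcongr
          have := mul_le_mul_of_nonneg_left hεS (Nat.cast_nonneg (α := ℝ) n)
          linarith
  have herr := one_sub_probJointlyTypical_le (R := R) pX pU e ε ε' x hT0
  have hsum := Finset.sum_le_card_nsmul Finset.univ _ _ fun k _ => hfew k
  rw [Finset.card_univ, Fintype.card_fin, nsmul_eq_mul, ← mul_assoc] at hsum
  linarith
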